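/- Let $p_{XYZ}$ be a probability distribution on a product $\mathcal X\times\mathcal Y\times\mathcal Z$ of finite sets, and let $$\rho_{ccc}=\sum_{x,y,z}p(x,y,z)\,|xyz\rangle\langle xyz|^{ABE}$$ be its incoherent quantum embedding, where $\{|x\rangle\}$, $\{|y\rangle\}$, $\{|z\rangle\}$ are the orthonormal computational bases of the systems of Alice, Bob and Eve. Then $$K_D(p_{XYZ})=K_D(\rho_{ccc}),$$ where the two key rates are defined as follows. *Classical LOPC (local operations and public communication).* In a classical LOPC protocol Alice and Bob perform finitely many steps, in each of which one of them generates a local random variable with finite alphabet, independent of all other variables; or changes (in particular, copies) the local variables by a function; or broadcasts a function, with finite range, of the local variables. What is done next may depend on the messages broadcast so far. At the end each of them applies a local channel, depending on the total message. Eve only listens to the public messages. Classical variables $G$ are represented by the diagonal states $\sum_g p(g)|g\rangle\langle g|$. *Quantum LOPC.* A quantum LOPC protocol is a finite tree of local quantum instruments of Alice and Bob on finite-dimensional systems (an instrument is a finite family $(\mathcal E_m)_m$ of completely positive maps whose sum is trace preserving). The outcome of each instrument is broadcast, and the party that acts next and its instrument depend on the history of outcomes. At the end each of them applies a local channel (a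 completely positive trace-preserving map), depending on the total message. Eve only listens to the public messages. For either kind of protocol $\mathcal P$ write $$\mathcal P(\sigma^{ABE})=\sum_m p(m)\,\sigma_m^{ABE}\otimes|m\rangle\langle m|,\qquad \omega_M=\sum_m p(m)|m\rangle\langle m|,$$ where $m$ runs over the total broadcast messages, $p(m)$ is the probability of $m$, and $\sigma_m^{ABE}$ is the final state of Alice, Bob and Eve given $m$. For an integer $r\ge 0$ let $$\Phi_r^{AB}=2^{-r}\sum_{i=1}^{2^r}|ii\rangle\langle ii|^{AB},$$ and let $\Phi_r:=\Phi_0$ for $r<0$. *Key rates.* A real number $R$ is achievable if for every $\epsilon>0$ and for all sufficiently large $n$ there is a protocol $\mathcal P$ acting on $\sigma^{ABE}=\rho_{ccc}^{\otimes n}$ such that $$\bigl\|\mathcal P(\sigma^{ABE})-\Phi^{AB}_{\lfloor nR-\epsilon\rfloor}\otimes\omega_M\otimes\sigma^E\bigr\|_1<\epsilon ,\qquad \sigma^E=\operatorname{tr}_{AB}\sigma^{ABE}.$$ $K_D(p_{XYZ})$ is the supremum of the numbers $R$ that are achievable with classical LOPC protocols, and $K_D(\rho_{ccc})$ is the supremum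 of the numbers $R$ that are achievable with quantum LOPC protocols. -/

import Mathlib

noncomputable section

namespace KeyDistillation

universe u v w

/-! ### Matrices: trace norm, partial traces, classical states, tensor powers -/

/-- The trace norm `‖M‖₁ = tr √(M† M)`, i.e. the sum of the singular values of `M`. -/
def traceNorm {I : Type*} [Fintype I] (M : Matrix I I ℂ) : ℝ :=
  letI := Classical.decEq I
  ∑ i, Real.sqrt ((Matrix.isHermitian_conjTranspose_mul_self M).eigenvalues i)

/-- Partial trace over the first factor. -/
def traceFst {I J : Type*} [Fintype I] (ρ : Matrix (I × J) (I × J) ℂ) : Matrix J J ℂ :=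
  Matrix.of fun j j' => ∑ i, ρ (i, j) (i, j')

/-- The state `σ^E = tr_{AB} σ^{ABE}`. -/
def eveMarginal {A B E : Type*} [Fintype A] [Fintype B]
    (σ : Matrix (A × B × E) (A × B × E) ℂ) : Matrix E E ℂ :=
  Matrix.of fun e e' => ∑ a, ∑ b, σ (a, b, e) (a, b, e')

/-- The diagonal density matrix `∑_g p(g) |g⟩⟨g|` that represents a random variable. -/
def classicalState {G : Type*} (p : PMF G) : Matrix G G ℂ :=
  letI := Classical.decEq G
  Matrix.diagonal fun g => ((p g).toReal : ℂ)

/-- The incoherent (ccc) embedding `∑ p(x,y,z) |xyz⟩⟨xyz|` of a tripartite distribution. -/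
def incoherentEmbedding {X Y Z : Type*} (p : PMF (X × Y × Z)) :
    Matrix (X × Y × Z) (X × Y × Z) ℂ :=
  classicalState p

/-- The tensor power `ρ^{⊗ n}` of a tripartite matrix, where the `n` systems of each
party are collected into one. -/
def tensorPower {X Y Z : Type*} (ρ : Matrix (X × Y × Z) (X × Y × Z) ℂ) (n : ℕ) :
    Matrix ((Fin n → X) × (Fin n → Y) × (Fin n → Z))
      ((Fin n → X) × (Fin n → Y) × (Fin n → Z)) ℂ :=
  Matrix.of fun s t => ∏ i, ρ (s.1 i, s.2.1 i, s.2.2 i) (t.1 i, t.2.1 i, t.2.2 i)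

/-- `n` triples versus a triple of `n`-tuples. -/
def tripleEquiv (X Y Z : Type*) (n : ℕ) :
    (Fin n → X × Y × Z) ≃ (Fin n → X) × (Fin n → Y) × (Fin n → Z) where
  toFun s := (fun i => (s i).1, fun i => (s i).2.1, fun i => (s i).2.2)
  invFun t i := (t.1 i, t.2.1 i, t.2.2 i)
  left_inv _ := rfl
  right_inv _ := rfl

/-- The `n`-fold product distribution `pⁿ(x,y,z) = ∏ i, p(x_i,y_i,z_i)`. -/
def iid {X Y Z : Type*} [Fintype X] [Fintype Y] [Fintype Z] (p : PMF (X × Y × Z)) (n : ℕ) :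
    PMF ((Fin n → X) × (Fin n → Y) × (Fin n → Z)) :=
  PMF.ofFintype (fun s => ∏ i, p (s.1 i, s.2.1 i, s.2.2 i)) (by
    rw [← (tripleEquiv X Y Z n).sum_comp]
    have h : ∑ g, p g = 1 := by rw [← tsum_fintype (L := .unconditional _), p.tsum_coe]
    have := Finset.prod_univ_sum (fun _ : Fin n => (Finset.univ : Finset (X × Y × Z)))
      (fun _ g => p g)
    simp only [h, Finset.prod_const_one, Fintype.piFinset_univ] at this
    exact this.symm)

/-- The `n`-th tensor power of the incoherent embedding of `p` is the classical state that
represents `pⁿ`. -/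
theorem tensorPower_incoherentEmbedding {X Y Z : Type*} [Fintype X] [Fintype Y] [Fintype Z]
    (p : PMF (X × Y × Z)) (n : ℕ) :
    tensorPower (incoherentEmbedding p) n = classicalState (iid p n) := by
  classical
  ext s t
  simp only [tensorPower, incoherentEmbedding, classicalState, iid, Matrix.of_apply,
    Matrix.diagonal_apply, PMF.ofFintype_apply, ENNReal.toReal_prod, Complex.ofReal_prod]
  by_cases hst : s = t
  · subst hst
    simp
  · rw [if_neg hst]
    have : ∃ i, (s.1 i, s.2.1 i, s.2.2 i) ≠ (t.1 i, t.2.1 i, t.2.2 i) := by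
      by_contra! h
      exact hst ((tripleEquiv X Y Z n).symm.injective (funext h))
    obtain ⟨i, hi⟩ := this
    exact Finset.prod_eq_zero (Finset.mem_univ i) (if_neg hi)

/-! ### Classical LOPC protocols -/

/-- A classical protocol with local operations and public communication, for Alice (whose
local variables take values in `A`) and Bob (in `B`). Each step is one of the following: a
party generates a local random variable `S` that is independent of everything else; a party
changes her local variables by a function (which includes copying); a party broadcasts a
function of her local variables. What follows a broadcast depends on the message. In the end
both parties apply local channels and output values in `KA` and `KB`. Eve is passive. -/
inductive ClassicalLOPC (KA KB : Type) : Type u → Type v → Type (max u v + 1)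
  | output {A : Type u} {B : Type v} (κA : A → PMF KA) (κB : B → PMF KB) :
      ClassicalLOPC KA KB A B
  | aliceRandom {A : Type u} {B : Type v} (S : Type u) [Fintype S] (q : PMF S)
      (next : ClassicalLOPC KA KB (A × S) B) : ClassicalLOPC KA KB A B
  | bobRandom {A : Type u} {B : Type v} (S : Type v) [Fintype S] (q : PMF S)
      (next : ClassicalLOPC KA KB A (B × S)) : ClassicalLOPC KA KB A B
  | aliceMap {A : Type u} {B : Type v} (A' : Type u) [Fintype A'] (f : A → A')
      (next : ClassicalLOPC KA KB A' B) : ClassicalLOPC KA KB A B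
  | bobMap {A : Type u} {B : Type v} (B' : Type v) [Fintype B'] (f : B → B')
      (next : ClassicalLOPC KA KB A B') : ClassicalLOPC KA KB A B
  | aliceBroadcast {A : Type u} {B : Type v} (m : ℕ) (f : A → Fin m)
      (next : Fin m → ClassicalLOPC KA KB A B) : ClassicalLOPC KA KB A B
  | bobBroadcast {A : Type u} {B : Type v} (m : ℕ) (f : B → Fin m)
      (next : Fin m → ClassicalLOPC KA KB A B) : ClassicalLOPC KA KB A B

namespace ClassicalLOPC

/-- The possible total public messages (sequences of broadcasts) of a protocol. -/
def Msg {KA KB : Type} : {A : Type u} → {B : Type v} → ClassicalLOPC KA KB A B → Type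
  | _, _, output _ _ => Unit
  | _, _, aliceRandom _ _ next => next.Msg
  | _, _, bobRandom _ _ next => next.Msg
  | _, _, aliceMap _ _ next => next.Msg
  | _, _, bobMap _ _ next => next.Msg
  | _, _, aliceBroadcast m _ next => Σ i : Fin m, (next i).Msg
  | _, _, bobBroadcast m _ next => Σ i : Fin m, (next i).Msg

instance fintypeMsg {KA KB : Type} :
    {A : Type u} → {B : Type v} → (P : ClassicalLOPC KA KB A B) → Fintype P.Msg
  | _, _, output _ _ => inferInstanceAs (Fintype Unit)
  | _, _, aliceRandom _ _ next => fintypeMsg next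
  | _, _, bobRandom _ _ next => fintypeMsg next
  | _, _, aliceMap _ _ next => fintypeMsg next
  | _, _, bobMap _ _ next => fintypeMsg next
  | _, _, aliceBroadcast m _ next =>
      letI := fun i => fintypeMsg (next i)
      inferInstanceAs (Fintype (Σ i : Fin m, (next i).Msg))
  | _, _, bobBroadcast m _ next =>
      letI := fun i => fintypeMsg (next i)
      inferInstanceAs (Fintype (Σ i : Fin m, (next i).Msg))

/-- The joint law of Alice's output, Bob's output and the total message, when Alice starts with
the value `a` and Bob with the value `b`. -/
def law {KA KB : Type} : {A : Type u} → {B : Type v} → (P : ClassicalLOPC KA KB A B) →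
    A → B → PMF ((KA × KB) × P.Msg)
  | _, _, output κA κB, a, b =>
      (κA a).bind fun k => (κB b).bind fun l => PMF.pure ((k, l), ())
  | _, _, aliceRandom _ q next, a, b => q.bind fun s => next.law (a, s) b
  | _, _, bobRandom _ q next, a, b => q.bind fun s => next.law a (b, s)
  | _, _, aliceMap _ f next, a, b => next.law (f a) b
  | _, _, bobMap _ f next, a, b => next.law a (f b)
  | _, _, aliceBroadcast _ f next, a, b =>
      ((next (f a)).law a b).map fun o => (o.1, ⟨f a, o.2⟩)
  | _, _, bobBroadcast _ f next, a, b =>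
      ((next (f b)).law a b).map fun o => (o.1, ⟨f b, o.2⟩)

/-- The joint law of Alice's output, Bob's output, Eve's variable and the total message, when
the protocol is run on variables with joint law `p`. -/
def outputLaw {KA KB : Type} {A : Type u} {B : Type v} {E : Type w}
    (P : ClassicalLOPC KA KB A B) (p : PMF (A × B × E)) : PMF ((KA × KB × E) × P.Msg) :=
  p.bind fun s => (P.law s.1 s.2.1).map fun o => ((o.1.1, o.1.2, s.2.2), o.2)

end ClassicalLOPC

/-! ### Quantum LOPC protocols -/

section CPMap

open scoped ComplexOrder Matrix.Norms.L2Operator MatrixOrder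

open Classical in
/-- Completely positive maps between matrix algebras. -/
abbrev CPMap (A : Type*) (A' : Type*) [Fintype A] [Fintype A'] :=
  CompletelyPositiveMap (Matrix A A ℂ) (Matrix A' A' ℂ)

open Classical in
/-- The linear map underlying a completely positive map. -/
def CPMap.lin {A A' : Type*} [Fintype A] [Fintype A'] (Φ : CPMap A A') :
    Matrix A A ℂ →ₗ[ℂ] Matrix A' A' ℂ :=
  Φ.toLinearMap

end CPMap

/-- A quantum instrument with outcomes in `M`: a finite family of completely positive maps
whose sum is trace preserving. -/
structure Instrument (M A A' : Type*) [Fintype M] [Fintype A] [Fintype A'] where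
  op : M → CPMap A A'
  trace_sum : ∀ σ : Matrix A A ℂ, (∑ m, CPMap.lin (op m) σ).trace = σ.trace

/-- A quantum channel is an instrument with a single outcome. -/
abbrev Channel (A A' : Type*) [Fintype A] [Fintype A'] := Instrument Unit A A'

/-- The action `(Φ ⊗ id ⊗ id) ρ` of a local map of Alice. -/
def onAlice {A A' B E : Type*} (Φ : Matrix A A ℂ →ₗ[ℂ] Matrix A' A' ℂ)
    (ρ : Matrix (A × B × E) (A × B × E) ℂ) : Matrix (A' × B × E) (A' × B × E) ℂ :=
  Matrix.of fun s t =>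
    Φ (Matrix.of fun a a' => ρ (a, s.2.1, s.2.2) (a', t.2.1, t.2.2)) s.1 t.1

/-- The action `(id ⊗ Φ ⊗ id) ρ` of a local map of Bob. -/
def onBob {A B B' E : Type*} (Φ : Matrix B B ℂ →ₗ[ℂ] Matrix B' B' ℂ)
    (ρ : Matrix (A × B × E) (A × B × E) ℂ) : Matrix (A × B' × E) (A × B' × E) ℂ :=
  Matrix.of fun s t =>
    Φ (Matrix.of fun b b' => ρ (s.1, b, s.2.2) (t.1, b', t.2.2)) s.2.1 t.2.1

/-- A quantum LOPC protocol for Alice (with Hilbert space `ℂ^A`) and Bob (`ℂ^B`): a finite tree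
of local instruments, where the outcome of every instrument is broadcast and the rest of
the protocol depends on it. (The maps of an instrument are arbitrary completely positive maps, so
a result that is not broadcast can be kept in the local system, and a local channel is an
instrument with one outcome.) In the end both parties apply local channels onto the output
systems `ℂ^KA` and `ℂ^KB`. Eve is passive. -/
inductive QuantumLOPC (KA KB : Type) [Fintype KA] [Fintype KB] :
    (A : Type u) → (B : Type v) → [Fintype A] → [Fintype B] → Type (max u v + 1)
  | output {A : Type u} {B : Type v} [Fintype A] [Fintype B]
      (𝓐 : Channel A KA) (𝓑 : Channel B KB) : QuantumLOPC KA KB A B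
  | alice {A : Type u} {B : Type v} [Fintype A] [Fintype B] (A' : Type u) [Fintype A'] (m : ℕ)
      (𝓐 : Instrument (Fin m) A A') (next : Fin m → QuantumLOPC KA KB A' B) :
      QuantumLOPC KA KB A B
  | bob {A : Type u} {B : Type v} [Fintype A] [Fintype B] (B' : Type v) [Fintype B'] (m : ℕ)
      (𝓑 : Instrument (Fin m) B B') (next : Fin m → QuantumLOPC KA KB A B') :
      QuantumLOPC KA KB A B

namespace QuantumLOPC

/-- The possible total public messages (sequences of measurement outcomes) of a protocol. -/
def Msg {KA KB : Type} [Fintype KA] [Fintype KB] : {A : Type u} → {B : Type v} →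
    [Fintype A] → [Fintype B] → QuantumLOPC KA KB A B → Type
  | _, _, _, _, output _ _ => Unit
  | _, _, _, _, alice _ m _ next => Σ i : Fin m, (next i).Msg
  | _, _, _, _, bob _ m _ next => Σ i : Fin m, (next i).Msg

instance fintypeMsg {KA KB : Type} [Fintype KA] [Fintype KB] : {A : Type u} → {B : Type v} →
    [Fintype A] → [Fintype B] → (P : QuantumLOPC KA KB A B) → Fintype P.Msg
  | _, _, _, _, output _ _ => inferInstanceAs (Fintype Unit)
  | _, _, _, _, alice _ m _ next =>
      letI := fun i => fintypeMsg (next i)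
      inferInstanceAs (Fintype (Σ i : Fin m, (next i).Msg))
  | _, _, _, _, bob _ m _ next =>
      letI := fun i => fintypeMsg (next i)
      inferInstanceAs (Fintype (Σ i : Fin m, (next i).Msg))

/-- The unnormalised state `p(m) σ_m` of Alice, Bob and Eve in the branch of the protocol in
which the total message is `m`. -/
def branch {KA KB : Type} [Fintype KA] [Fintype KB] {E : Type w} :
    {A : Type u} → {B : Type v} → [Fintype A] → [Fintype B] → (P : QuantumLOPC KA KB A B) →
    Matrix (A × B × E) (A × B × E) ℂ → P.Msg → Matrix (KA × KB × E) (KA × KB × E) ℂ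
  | _, _, _, _, output 𝓐 𝓑, σ => fun _ =>
      onBob (CPMap.lin (𝓑.op ())) (onAlice (CPMap.lin (𝓐.op ())) σ)
  | _, _, _, _, alice _ m 𝓐 next, σ => fun (o : Σ i : Fin m, (next i).Msg) =>
      (next o.1).branch (onAlice (CPMap.lin (𝓐.op o.1)) σ) o.2
  | _, _, _, _, bob _ m 𝓑 next, σ => fun (o : Σ i : Fin m, (next i).Msg) =>
      (next o.1).branch (onBob (CPMap.lin (𝓑.op o.1)) σ) o.2

/-- The output `∑_m p(m) σ_m ⊗ |m⟩⟨m|` of the protocol. -/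
def outputState {KA KB : Type} [Fintype KA] [Fintype KB] {A : Type u} {B : Type v} {E : Type w}
    [Fintype A] [Fintype B] (P : QuantumLOPC KA KB A B) (σ : Matrix (A × B × E) (A × B × E) ℂ) :
    Matrix ((KA × KB × E) × P.Msg) ((KA × KB × E) × P.Msg) ℂ :=
  letI := Classical.decEq P.Msg
  Matrix.blockDiagonal fun m => P.branch σ m

end QuantumLOPC

/-! ### Secret key -/

/-- The state `(1/s) ∑_i |ii⟩⟨ii|` of `log s` bits of perfectly shared randomness. -/
def sharedKey (s : ℕ) : Matrix (Fin s × Fin s) (Fin s × Fin s) ℂ :=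
  Matrix.diagonal fun k => if k.1 = k.2 then (1 / s : ℂ) else 0

/-- The trace distance `‖τ - Φ ⊗ ω_M ⊗ σ^E‖₁` between the output `τ` of a protocol with public
messages in `M` and a perfect key; `ω_M` is the message part of `τ`, and `σ` is the
state of Alice, Bob and Eve on which the protocol was run. -/
def keyError {A B E M : Type*} [Fintype A] [Fintype B] [Fintype E] [Fintype M] (s : ℕ)
    (τ : Matrix ((Fin s × Fin s × E) × M) ((Fin s × Fin s × E) × M) ℂ)
    (σ : Matrix (A × B × E) (A × B × E) ℂ) : ℝ :=
  traceNorm (τ - Matrix.of fun g h =>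
    sharedKey s (g.1.1, g.1.2.1) (h.1.1, h.1.2.1) *
      (traceFst τ g.2 h.2 * eveMarginal σ g.1.2.2 h.1.2.2))

/-- The number of values of a key of `⌊n R - ε⌋` bits; a negative number of bits counts as
zero bits. -/
def keySize (n : ℕ) (R ε : ℝ) : ℕ := 2 ^ ⌊n * R - ε⌋₊

/-- `R` is achievable from the distribution `p` by classical LOPC. -/
def IsClassicallyAchievable {X : Type u} {Y : Type v} {Z : Type w} [Fintype X] [Fintype Y]
    [Fintype Z] (p : PMF (X × Y × Z)) (R : ℝ) : Prop :=
  ∀ ε : ℝ, 0 < ε → ∀ᶠ n : ℕ in Filter.atTop,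
    ∃ P : ClassicalLOPC (Fin (keySize n R ε)) (Fin (keySize n R ε)) (Fin n → X) (Fin n → Y),
      keyError (keySize n R ε) (classicalState (P.outputLaw (iid p n)))
        (classicalState (iid p n)) < ε

/-- `R` is achievable from the tripartite state `ρ` by quantum LOPC. -/
def IsQuantumAchievable {X : Type u} {Y : Type v} {Z : Type w} [Fintype X] [Fintype Y]
    [Fintype Z] (ρ : Matrix (X × Y × Z) (X × Y × Z) ℂ) (R : ℝ) : Prop :=
  ∀ ε : ℝ, 0 < ε → ∀ᶠ n : ℕ in Filter.atTop,
    ∃ P : QuantumLOPC (Fin (keySize n R ε)) (Fin (keySize n R ε)) (Fin n → X) (Fin n → Y),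
      keyError (keySize n R ε) (P.outputState (tensorPower ρ n)) (tensorPower ρ n) < ε

/-- The classical key rate `K_D(p)`: the supremum of the classically achievable rates. -/
def classicalKeyRate {X : Type u} {Y : Type v} {Z : Type w} [Fintype X] [Fintype Y]
    [Fintype Z] (p : PMF (X × Y × Z)) : EReal :=
  sSup ((fun R : ℝ => (R : EReal)) '' {R | IsClassicallyAchievable p R})

/-- The key rate `K_D(ρ)`: the supremum of the rates achievable by quantum LOPC. -/
def quantumKeyRate {X : Type u} {Y : Type v} {Z : Type w} [Fintype X] [Fintype Y]
    [Fintype Z] (ρ : Matrix (X × Y × Z) (X × Y × Z) ℂ) : EReal :=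
  sSup ((fun R : ℝ => (R : EReal)) '' {R | IsQuantumAchievable ρ R})

end KeyDistillation

end

noncomputable section

namespace KeyDistillation

universe u v w

/-! ### The trace norm and the diagonal -/

/-! The two rates are suprema of the same set: for each block length and key size, either kind of
protocol can be replaced by one of the other kind with no larger error.

From classical to quantum (`exists_quantum_keyError_eq`): every classical step is a stochastic
kernel, hence an instrument that measures in the computational basis and prepares basis states. On a
classical state the output is again diagonal and carries the law of the classical protocol, so the
errors agree.

From quantum to classical (`exists_classical_keyError_le`): the input is a mixture of products of
basis states. Given the initial values and the messages so far, the global state stays a product,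
and each party can compute her own factor from her own value and the transcript. She can therefore
sample the outcomes of her instruments classically, and at the end a measurement in the
computational basis (`QuantumLOPC.exists_classicalLOPC`). The resulting law is the diagonal of the
quantum output. The diagonal of the ideal state depends only on the diagonals of the output and of
Eve's state, and restricting to the diagonal does not increase the trace norm
(`sum_norm_diag_le_traceNorm`), so the error does not grow. -/

/-- Pinching does not increase the trace norm. -/
theorem sum_norm_diag_le_traceNorm {I : Type*} [Fintype I] (M : Matrix I I ℂ) :
    ∑ i, ‖M i i‖ ≤ traceNorm M := by
  classical
  have hH := Matrix.isHermitian_conjTranspose_mul_self M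
  obtain ⟨U, hU⟩ : ∃ U : Matrix I I ℂ, U = hH.eigenvectorUnitary := ⟨_, rfl⟩
  have hUU : U.conjTranspose * U = 1 := by
    rw [hU]; exact Matrix.mem_unitaryGroup_iff'.1 hH.eigenvectorUnitary.2
  have hUU' : U * U.conjTranspose = 1 := by
    rw [hU]; exact Matrix.mem_unitaryGroup_iff.1 hH.eigenvectorUnitary.2
  -- The columns of `M * U` are orthogonal, and their lengths are the singular values of `M`.
  have hspec : (M * U).conjTranspose * (M * U) =
      Matrix.diagonal fun j => (hH.eigenvalues j : ℂ) := by
    have h2 : (M.conjTranspose * M) * U =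
        U * Matrix.diagonal fun j => (hH.eigenvalues j : ℂ) := by
      ext k l
      have h := congrFun (hH.mulVec_eigenvectorBasis l) k
      rw [Matrix.mul_diagonal, Matrix.mul_apply, hU]
      simpa [Matrix.mulVec, dotProduct, mul_comm] using h
    rw [Matrix.conjTranspose_mul, Matrix.mul_assoc, ← Matrix.mul_assoc _ M U, h2,
      ← Matrix.mul_assoc, hUU, Matrix.one_mul]
  have hsq : ∀ (N : Matrix I I ℂ) (j : I),
      ((∑ i, ‖N i j‖ ^ 2 : ℝ) : ℂ) = (N.conjTranspose * N) j j := by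
    intro N j
    rw [Matrix.mul_apply]
    push_cast
    refine Finset.sum_congr rfl fun i _ => ?_
    rw [Matrix.conjTranspose_apply, RCLike.star_def, Complex.conj_mul']
  have hMU : ∀ j, ∑ i, ‖(M * U) i j‖ ^ 2 = hH.eigenvalues j := by
    intro j
    have := hsq (M * U) j
    rw [hspec, Matrix.diagonal_apply_eq] at this
    exact_mod_cast this
  have hU1 : ∀ j, ∑ i, ‖U i j‖ ^ 2 = 1 := by
    intro j
    have := hsq U j
    rw [hUU, Matrix.one_apply_eq] at this
    exact_mod_cast this
  have hM : ∀ i, ‖M i i‖ ≤ ∑ j, ‖(M * U) i j‖ * ‖U i j‖ := by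
    intro i
    have : M i i = ∑ j, (M * U) i j * star (U i j) := by
      conv_lhs => rw [← Matrix.mul_one M, ← hUU', ← Matrix.mul_assoc, Matrix.mul_apply]
      rfl
    rw [this]
    refine (norm_sum_le _ _).trans (le_of_eq ?_)
    simp
  calc ∑ i, ‖M i i‖ ≤ ∑ i, ∑ j, ‖(M * U) i j‖ * ‖U i j‖ := Finset.sum_le_sum fun i _ => hM i
    _ = ∑ j, ∑ i, ‖(M * U) i j‖ * ‖U i j‖ := Finset.sum_comm
    -- Cauchy–Schwarz in each column: column `j` of `M * U` has norm `√λ_j`, column `j` of `U` has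
    -- norm 1.
    _ ≤ ∑ j, Real.sqrt (hH.eigenvalues j) := by
      refine Finset.sum_le_sum fun j _ => ?_
      have := Real.sum_mul_le_sqrt_mul_sqrt Finset.univ
        (fun i => ‖(M * U) i j‖) (fun i => ‖U i j‖)
      rwa [hMU, hU1, Real.sqrt_one, mul_one] at this
    _ = traceNorm M := by
      unfold traceNorm
      congr!

theorem traceNorm_diagonal {I : Type*} [Fintype I] [DecidableEq I] (d : I → ℂ) :
    traceNorm (Matrix.diagonal d) = ∑ i, ‖d i‖ := by
  -- `eigenvalues` fixes an ordering of its own, so only the multisets can be compared: both are the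
  -- roots of the characteristic polynomial, and the sum of square roots is symmetric in them.
  have key : ∀ (N : Matrix I I ℂ) (hN : N.IsHermitian) (c : I → ℝ),
      N = Matrix.diagonal (fun i => (c i : ℂ)) →
      ∑ i, Real.sqrt (hN.eigenvalues i) = ∑ i, Real.sqrt (c i) := by
    intro N hN c hc
    have h1 := hN.roots_charpoly_eq_eigenvalues
    have h2 : N.charpoly.roots = Multiset.map (fun i => (c i : ℂ)) Finset.univ.val := by
      rw [hc, Matrix.charpoly_diagonal, Polynomial.roots_prod _ _
        (Finset.prod_ne_zero_iff.2 fun i _ => Polynomial.X_sub_C_ne_zero _)]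
      simp only [Polynomial.roots_X_sub_C, Multiset.bind_singleton]
    rw [h2] at h1
    have h3 := congrArg (fun m => (m.map fun z : ℂ => Real.sqrt z.re).sum) h1
    simp only [Multiset.map_map] at h3
    exact h3.symm
  have hdiag : (Matrix.diagonal d).conjTranspose * Matrix.diagonal d =
      Matrix.diagonal fun i => ((‖d i‖ ^ 2 : ℝ) : ℂ) := by
    rw [Matrix.diagonal_conjTranspose, Matrix.diagonal_mul_diagonal]
    congr 1
    ext i
    rw [Pi.star_apply, RCLike.star_def, Complex.conj_mul']
    push_cast
    rfl
  unfold traceNorm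
  rw [Subsingleton.elim (Classical.decEq I) ‹DecidableEq I›]
  simp only [key _ (Matrix.isHermitian_conjTranspose_mul_self _) _ hdiag, Real.sqrt_sq,
    norm_nonneg]

/-! ### The key error read off the diagonal -/

/-- The trace distance to a perfect key of a state and its ideal with diagonals `t` and `v`. -/
def diagError {E M : Type*} [Fintype E] [Fintype M] (s : ℕ)
    (t : (Fin s × Fin s × E) × M → ℂ) (v : E → ℂ) : ℝ :=
  ∑ g : (Fin s × Fin s × E) × M,
    ‖t g - sharedKey s (g.1.1, g.1.2.1) (g.1.1, g.1.2.1) * ((∑ i, t (i, g.2)) * v g.1.2.2)‖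

/-- The ideal state is a product, so its diagonal entries involve only diagonal entries of `τ` and
of Eve's marginal; pinching then gives the bound. -/
theorem diagError_le_keyError {A B E M : Type*} [Fintype A] [Fintype B] [Fintype E] [Fintype M]
    (s : ℕ) (τ : Matrix ((Fin s × Fin s × E) × M) ((Fin s × Fin s × E) × M) ℂ)
    (σ : Matrix (A × B × E) (A × B × E) ℂ) :
    diagError s (fun g => τ g g) (fun e => eveMarginal σ e e) ≤ keyError s τ σ := by
  unfold diagError keyError
  refine le_trans (le_of_eq ?_) (sum_norm_diag_le_traceNorm _)
  rfl

theorem keyError_diagonal {A B E M : Type*} [Fintype A] [Fintype B] [Fintype E] [Fintype M]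
    [DecidableEq M] [DecidableEq E] [DecidableEq A] [DecidableEq B]
    (s : ℕ) (t : (Fin s × Fin s × E) × M → ℂ) (q : A × B × E → ℂ) :
    keyError s (Matrix.diagonal t) (Matrix.diagonal q) =
      diagError s t (fun e => ∑ a, ∑ b, q (a, b, e)) := by
  unfold keyError diagError
  rw [← traceNorm_diagonal]
  congr 1
  ext ⟨⟨k, l, e⟩, m⟩ ⟨⟨k', l', e'⟩, m'⟩
  by_cases hm : m = m'
  · by_cases he : e = e'
    · by_cases hk : k = k' ∧ l = l'
      · obtain ⟨rfl, rfl⟩ := hk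
        subst hm he
        simp [traceFst, eveMarginal]
      · have hk' : ¬((k = k' ∧ l = l' ∧ e = e') ∧ m = m') := fun h => hk ⟨h.1.1, h.1.2.1⟩
        simp [sharedKey, Matrix.diagonal_apply, hk, hk', Prod.ext_iff]
    · simp [Matrix.diagonal_apply, he, Prod.ext_iff, eveMarginal]
  · simp [Matrix.diagonal_apply, hm, Prod.ext_iff, traceFst]

theorem diagError_reindex {E M M' : Type*} [Fintype E] [Fintype M] [Fintype M'] (s : ℕ)
    (e : M ≃ M') (t : (Fin s × Fin s × E) × M → ℂ) (t' : (Fin s × Fin s × E) × M' → ℂ)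
    (h : ∀ g m, t (g, m) = t' (g, e m)) (v : E → ℂ) :
    diagError s t v = diagError s t' v := by
  unfold diagError
  refine Fintype.sum_equiv ((Equiv.refl _).prodCongr e) _ _ ?_
  rintro ⟨g, m⟩
  simp [h]

theorem cstarMatrix_sum_apply {ι k R : Type*} [AddCommMonoid R] (s : Finset ι)
    (f : ι → CStarMatrix k k R) (i j : k) : (∑ x ∈ s, f x) i j = ∑ x ∈ s, f x i j :=
  map_sum ({ toFun := fun M => M i j, map_zero' := rfl, map_add' := fun _ _ => rfl } :
    CStarMatrix k k R →+ R) f s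

/-! ### Positivity of completely positive maps, and measure-and-prepare maps -/

section CPMap

open scoped ComplexOrder Matrix.Norms.L2Operator MatrixOrder

/-- Keeps the conditional states of a party positive along the protocol, so that diagonal entries
can serve as sampling weights. -/
theorem CPMap.posSemidef {A A' : Type*} [Fintype A] [Fintype A'] (Φ : CPMap A A')
    {σ : Matrix A A ℂ} (hσ : σ.PosSemidef) : (CPMap.lin Φ σ).PosSemidef := by
  classical
  have := OrderHomClass.mono Φ hσ.nonneg
  rw [map_zero] at this
  exact Matrix.nonneg_iff_posSemidef.1 this

/-- Measure in the computational basis, then prepare basis states: the linear map with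
`|a⟩⟨a| ↦ ∑ a', w a a' |a'⟩⟨a'|` which annihilates off-diagonal entries. -/
def measurePrepareLin {A A' : Type*} [Fintype A] [DecidableEq A'] (w : A → A' → NNReal) :
    Matrix A A ℂ →ₗ[ℂ] Matrix A' A' ℂ where
  toFun σ := Matrix.diagonal fun a' => ∑ a, (w a a' : ℂ) * σ a a
  map_add' σ τ := by
    ext i j
    by_cases h : i = j <;> simp [h, mul_add, Finset.sum_add_distrib]
  map_smul' c σ := by
    ext i j
    by_cases h : i = j <;> simp [h, Finset.mul_sum, mul_left_comm]

open Classical in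
/-- The completely positive map with transition weights `w`. -/
def measurePrepare {A A' : Type*} [Fintype A] [Fintype A'] (w : A → A' → NNReal) : CPMap A A' where
  toLinearMap := measurePrepareLin w
  map_cstarMatrix_nonneg' k M hM := by
    change 0 ≤ CStarMatrix.map M (measurePrepareLin w)
    -- Nonnegative elements are generated additively by the `star N * N`, so it suffices to treat
    -- one of these.
    rw [StarOrderedRing.nonneg_iff] at hM
    induction hM using AddSubmonoid.closure_induction with
    | zero =>
      have : CStarMatrix.map (0 : CStarMatrix (Fin k) (Fin k) (Matrix A A ℂ))
          (measurePrepareLin w) = 0 := by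
        refine CStarMatrix.ext fun i j => ?_
        exact map_zero (measurePrepareLin w)
      rw [this]
    | add M N _ _ hM hN =>
      have : CStarMatrix.map (M + N) (measurePrepareLin w) =
          M.map (measurePrepareLin w) + N.map (measurePrepareLin w) := by
        refine CStarMatrix.ext fun i j => ?_
        exact map_add (measurePrepareLin w) _ _
      rw [this]
      exact add_nonneg hM hN
    | mem M hM =>
      obtain ⟨N, rfl⟩ := hM
      -- Square roots witnessing positivity of the image: the `(a, a)` entry of block `(i, j)` of
      -- `star N * N` is the sum over `r` and `l` of `star (N l i r a) * N l j r a`. The sum over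
      -- `l` comes from multiplying the blocks of `W`, the sum over `r` is taken outside, and the
      -- weight is split into two factors `√w`.
      let W : A → A → A' → CStarMatrix (Fin k) (Fin k) (Matrix A' A' ℂ) := fun a r a' =>
        CStarMatrix.ofMatrix (Matrix.of fun l i =>
          Matrix.single a' a' ((Real.sqrt (w a a') : ℂ) * N l i r a))
      have : CStarMatrix.map (star N * N) (measurePrepareLin w) =
          ∑ a, ∑ r, ∑ a', star (W a r a') * W a r a' := by
        refine CStarMatrix.ext fun i j => ?_
        have hW : ∀ a r a', (star (W a r a') * W a r a') i j =
            Matrix.single a' a' ((w a a' : ℂ) * ∑ l, star (N l i r a) * N l j r a) := by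
          intro a r a'
          have hw : (Real.sqrt (w a a') : ℂ) * Real.sqrt (w a a') = (w a a' : ℂ) := by
            exact_mod_cast Real.mul_self_sqrt (w a a').2
          have hl : ∀ l, star (W a r a' l i) * W a r a' l j =
              Matrix.single a' a' ((w a a' : ℂ) * (star (N l i r a) * N l j r a)) := by
            intro l
            simp only [W, CStarMatrix.ofMatrix_apply, Matrix.of_apply, Matrix.star_eq_conjTranspose,
              Matrix.conjTranspose_single, Matrix.single_mul_single_same]
            congr 1
            rw [← hw]
            simp only [star_mul', RCLike.star_def, Complex.conj_ofReal]
            ring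
          rw [CStarMatrix.mul_apply, Finset.mul_sum]
          simp only [CStarMatrix.star_apply, hl]
          exact (map_sum (Matrix.singleAddMonoidHom (α := ℂ) a' a') _ _).symm
        simp only [cstarMatrix_sum_apply, hW]
        ext b c
        have hN : ∀ a, (star N * N) i j a a = ∑ r, ∑ l, star (N l i r a) * N l j r a := by
          intro a
          rw [CStarMatrix.mul_apply, Matrix.sum_apply, Finset.sum_comm]
          rfl
        change Matrix.diagonal (fun a' => ∑ a, (w a a' : ℂ) * (star N * N) i j a a) b c = _
        simp only [Matrix.sum_apply, Matrix.diagonal_apply, Matrix.single_apply, hN]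
        by_cases hbc : b = c
        · subst hbc
          simp only [if_true, and_self, Finset.sum_ite_eq', Finset.mem_univ, Finset.mul_sum]
        · have : ∀ x, ¬(x = b ∧ x = c) := fun x h => hbc (h.1.symm.trans h.2)
          simp only [hbc, this, if_false, Finset.sum_const_zero]
      dsimp only
      rw [this]
      exact Finset.sum_nonneg fun a _ => Finset.sum_nonneg fun r _ => Finset.sum_nonneg fun a' _ =>
        star_mul_self_nonneg _

theorem measurePrepare_lin {A A' : Type*} [Fintype A] [Fintype A'] [DecidableEq A']
    (w : A → A' → NNReal) (σ : Matrix A A ℂ) :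
    CPMap.lin (measurePrepare w) σ = Matrix.diagonal fun a' => ∑ a, (w a a' : ℂ) * σ a a := by
  obtain rfl : ‹DecidableEq A'› = fun a b => Classical.propDecidable (a = b) :=
    Subsingleton.elim _ _
  rfl

end CPMap

/-! ### Product states, diagonal states and linearity of protocols -/

/-- The product operator `α ⊗ β ⊗ ε`. -/
def prodState {A B E : Type*} (α : Matrix A A ℂ) (β : Matrix B B ℂ) (ε : Matrix E E ℂ) :
    Matrix (A × B × E) (A × B × E) ℂ :=
  Matrix.of fun s t => α s.1 t.1 * (β s.2.1 t.2.1 * ε s.2.2 t.2.2)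

/-- The diagonal matrix with entries `d`. -/
def diagState {G : Type*} (d : G → ℂ) : Matrix G G ℂ :=
  letI := Classical.decEq G
  Matrix.diagonal d

theorem diagState_apply {G : Type*} [DecidableEq G] (d : G → ℂ) (g h : G) :
    diagState d g h = if g = h then d g else 0 := by
  obtain rfl : ‹DecidableEq G› = Classical.decEq G := Subsingleton.elim _ _
  rfl

@[simp]
theorem diagState_self {G : Type*} (d : G → ℂ) (g : G) : diagState d g g = d g :=
  letI := Classical.decEq G
  Matrix.diagonal_apply_eq _ _

theorem diagState_ne {G : Type*} (d : G → ℂ) {g h : G} (hgh : g ≠ h) : diagState d g h = 0 :=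
  letI := Classical.decEq G
  Matrix.diagonal_apply_ne _ hgh

theorem diagState_eq {G : Type*} [DecidableEq G] (d : G → ℂ) :
    diagState d = Matrix.diagonal d := by
  ext g h
  rw [diagState_apply, Matrix.diagonal_apply]

/-- The basis state `|g⟩⟨g|`. -/
def basisState {G : Type*} (g : G) : Matrix G G ℂ :=
  letI := Classical.decEq G
  diagState (Pi.single g 1)

theorem onAlice_prodState {A A' B E : Type*} (Φ : Matrix A A ℂ →ₗ[ℂ] Matrix A' A' ℂ)
    (α : Matrix A A ℂ) (β : Matrix B B ℂ) (ε : Matrix E E ℂ) :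
    onAlice Φ (prodState α β ε) = prodState (Φ α) β ε := by
  ext s t
  -- Each slice of a product operator is a scalar multiple of `α`, so linearity of `Φ` suffices.
  have : (Matrix.of fun a a' => prodState α β ε (a, s.2.1, s.2.2) (a', t.2.1, t.2.2)) =
      (β s.2.1 t.2.1 * ε s.2.2 t.2.2) • α := by
    ext a a'
    simp [prodState, mul_comm]
  simp only [onAlice, Matrix.of_apply, this, map_smul, Matrix.smul_apply, smul_eq_mul]
  simp [prodState, mul_comm]

theorem onBob_prodState {A B B' E : Type*} (Φ : Matrix B B ℂ →ₗ[ℂ] Matrix B' B' ℂ)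
    (α : Matrix A A ℂ) (β : Matrix B B ℂ) (ε : Matrix E E ℂ) :
    onBob Φ (prodState α β ε) = prodState α (Φ β) ε := by
  ext s t
  have : (Matrix.of fun b b' => prodState α β ε (s.1, b, s.2.2) (t.1, b', t.2.2)) =
      (α s.1 t.1 * ε s.2.2 t.2.2) • β := by
    ext a a'
    simp [prodState, mul_left_comm, mul_comm]
  simp only [onBob, Matrix.of_apply, this, map_smul, Matrix.smul_apply, smul_eq_mul]
  simp [prodState, mul_assoc, mul_comm]

theorem isLinearMap_onAlice {A A' B E : Type*} (Φ : Matrix A A ℂ →ₗ[ℂ] Matrix A' A' ℂ) :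
    IsLinearMap ℂ (onAlice Φ : Matrix (A × B × E) (A × B × E) ℂ → _) where
  map_add ρ τ := by
    ext s t
    exact congrFun (congrFun (map_add Φ _ _) s.1) t.1
  map_smul c ρ := by
    ext s t
    exact congrFun (congrFun (map_smul Φ c _) s.1) t.1

theorem isLinearMap_onBob {A B B' E : Type*} (Φ : Matrix B B ℂ →ₗ[ℂ] Matrix B' B' ℂ) :
    IsLinearMap ℂ (onBob Φ : Matrix (A × B × E) (A × B × E) ℂ → _) where
  map_add ρ τ := by
    ext s t
    exact congrFun (congrFun (map_add Φ _ _) s.2.1) t.2.1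
  map_smul c ρ := by
    ext s t
    exact congrFun (congrFun (map_smul Φ c _) s.2.1) t.2.1

/-- Each branch composes local linear maps without renormalisation. This reduces the analysis of a
classical input to products of basis states. -/
theorem QuantumLOPC.isLinearMap_branch {KA KB : Type} [Fintype KA] [Fintype KB] {A : Type u}
    {B : Type v} [Fintype A] [Fintype B] (Q : QuantumLOPC KA KB A B) :
    ∀ {E : Type w} (m : Q.Msg), IsLinearMap ℂ fun σ : Matrix (A × B × E) (A × B × E) ℂ =>
      Q.branch σ m := by
  induction Q with
  | output 𝓐 𝓑 =>
    intro E m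
    exact (((isLinearMap_onBob _).mk' _).comp ((isLinearMap_onAlice _).mk' _)).isLinear
  | alice A' m 𝓐 next ih =>
    rintro E ⟨i, m⟩
    exact (((ih i m).mk' _).comp ((isLinearMap_onAlice _).mk' _)).isLinear
  | bob B' m 𝓑 next ih =>
    rintro E ⟨i, m⟩
    exact (((ih i m).mk' _).comp ((isLinearMap_onBob _).mk' _)).isLinear

theorem classicalState_eq_sum {A B E : Type*} [Fintype A] [Fintype B] [Fintype E]
    (p : PMF (A × B × E)) :
    classicalState p = ∑ s, ((p s).toReal : ℂ) •
      prodState (basisState s.1) (basisState s.2.1) (basisState s.2.2) := by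
  classical
  change diagState _ = _
  ext ⟨a, b, e⟩ ⟨a', b', e'⟩
  rw [Matrix.sum_apply, Finset.sum_eq_single (a, b, e)]
  · simp only [diagState_apply, basisState, prodState, Matrix.smul_apply, Matrix.of_apply,
      Prod.mk.injEq, smul_eq_mul]
    by_cases ha : a = a' <;> by_cases hb : b = b' <;> by_cases he : e = e' <;>
      simp [ha, hb, he]
  · rintro ⟨x, y, z⟩ - h
    simp only [diagState_apply, basisState, prodState, Matrix.smul_apply, Matrix.of_apply,
      smul_eq_mul, Pi.single_apply]
    by_cases ha : a = x <;> by_cases hb : b = y <;> by_cases he : e = z <;>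
      simp [ha, hb, he]
    exact absurd (by rw [ha, hb, he]) h
  · simp

theorem QuantumLOPC.branch_classicalState {KA KB : Type} [Fintype KA] [Fintype KB] {A : Type u}
    {B : Type v} [Fintype A] [Fintype B] (Q : QuantumLOPC KA KB A B) {E : Type w} [Fintype E]
    (p : PMF (A × B × E)) (m : Q.Msg) :
    Q.branch (classicalState p) m = ∑ s, ((p s).toReal : ℂ) •
      Q.branch (prodState (basisState s.1) (basisState s.2.1) (basisState s.2.2)) m := by
  have h := map_sum ((Q.isLinearMap_branch (E := E) m).mk' _)
    (fun s : A × B × E => ((p s).toReal : ℂ) •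
      prodState (basisState s.1) (basisState s.2.1) (basisState s.2.2)) Finset.univ
  rw [← classicalState_eq_sum] at h
  simp only [map_smul] at h
  exact h

/-! ### Probability mass functions on finite types -/

theorem toReal_bind_apply {α β : Type*} [Fintype α] (p : PMF α) (f : α → PMF β) (b : β) :
    (p.bind f b).toReal = ∑ a, (p a).toReal * (f a b).toReal := by
  rw [PMF.bind_apply, tsum_fintype, ENNReal.toReal_sum]
  · simp
  · exact fun a _ => ENNReal.mul_ne_top (p.apply_ne_top a) ((f a).apply_ne_top b)

theorem sum_toReal_eq_one {α : Type*} [Fintype α] (p : PMF α) : ∑ a, (p a).toReal = 1 := by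
  rw [← ENNReal.toReal_sum fun a _ => p.apply_ne_top a, ← tsum_fintype (L := .unconditional _),
    p.tsum_coe, ENNReal.toReal_one]

theorem map_apply_of_injective {α β : Type*} (p : PMF α) {f : α → β} (hf : f.Injective) (a : α) :
    p.map f (f a) = p a := by
  rw [PMF.map_apply, tsum_eq_single a]
  · simp
  · intro a' h
    rw [if_neg fun h' => h (hf h').symm]

theorem map_apply_of_forall_ne {α β : Type*} (p : PMF α) {f : α → β} {b : β}
    (h : ∀ a, f a ≠ b) : p.map f b = 0 := by
  rw [PMF.map_apply, ENNReal.tsum_eq_zero]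
  exact fun a => if_neg fun h' => h a h'.symm

/-- Local random variables that are jointly independent, with prescribed laws. -/
theorem exists_pmf_pi {A M : Type*} [Fintype A] [DecidableEq A] [Fintype M] (D : A → PMF M) :
    ∃ q : PMF (A → M), ∀ (a : A) (F : M → ℝ),
      ∑ g, (q g).toReal * F (g a) = ∑ i, (D a i).toReal * F i := by
  have hsum : ∀ F : A → M → ENNReal, ∑ g : A → M, ∏ b, F b (g b) = ∏ b, ∑ i, F b i := fun F => by
    have := Finset.prod_univ_sum (fun _ : A => (Finset.univ : Finset M)) F
    rw [Fintype.piFinset_univ] at this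
    exact this.symm
  have h1 : ∀ b, ∑ i, D b i = 1 := fun b => by
    rw [← tsum_fintype (L := .unconditional _), (D b).tsum_coe]
  have hsumR : ∀ F : A → M → ℝ, ∑ g : A → M, ∏ b, F b (g b) = ∏ b, ∑ i, F b i := fun F => by
    have := Finset.prod_univ_sum (fun _ : A => (Finset.univ : Finset M)) F
    rw [Fintype.piFinset_univ] at this
    exact this.symm
  refine ⟨PMF.ofFintype (fun g => ∏ b, D b (g b)) (by rw [hsum]; simp [h1]), fun a F => ?_⟩
  -- The test function is `F` in coordinate `a` and 1 elsewhere, so the sum factorises and every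
  -- other coordinate contributes total mass 1.
  have h2 := hsumR fun b i => (D b i).toReal * if b = a then F i else 1
  simp only [Finset.prod_mul_distrib, Finset.prod_ite_eq', Finset.mem_univ, if_true] at h2
  simp only [PMF.ofFintype_apply, ENNReal.toReal_prod]
  rw [h2, Finset.prod_eq_single a]
  · simp
  · intro b _ hb
    simp [hb, sum_toReal_eq_one]
  · simp

/-! ### Laws of classical protocols -/

namespace ClassicalLOPC

variable {KA KB : Type} {A : Type u} {B : Type v}

theorem law_output (κA : A → PMF KA) (κB : B → PMF KB) (a : A) (b : B) (k : KA) (l : KB)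
    (m : (output κA κB).Msg) :
    (output κA κB).law a b ((k, l), m) = κA a k * κB b l := by
  classical
  simp only [law, PMF.bind_apply, PMF.pure_apply]
  rw [tsum_eq_single k, tsum_eq_single l]
  · have : m = () := rfl
    simp [this]
  · intro l' h
    rw [if_neg fun h' => h (congrArg (fun o => o.1.2) h').symm, mul_zero]
  · intro k' h
    rw [ENNReal.tsum_eq_zero.2, mul_zero]
    intro l'
    rw [if_neg fun h' => h (congrArg (fun o => o.1.1) h').symm, mul_zero]

theorem law_aliceBroadcast (n : ℕ) (f : A → Fin n) (next : Fin n → ClassicalLOPC KA KB A B)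
    (a : A) (b : B) (o : KA × KB) (i : Fin n) (m : (next i).Msg) :
    (aliceBroadcast n f next).law a b (o, (⟨i, m⟩ : Σ i, (next i).Msg)) =
      if f a = i then (next i).law a b (o, m) else 0 := by
  split_ifs with h
  · subst h
    exact map_apply_of_injective ((next (f a)).law a b)
      (f := fun o => (o.1, (⟨f a, o.2⟩ : Σ i, (next i).Msg)))
      (fun x y h => by simpa [Prod.ext_iff] using h) (o, m)
  · exact map_apply_of_forall_ne ((next (f a)).law a b)
      (f := fun o => (o.1, (⟨f a, o.2⟩ : Σ i, (next i).Msg)))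
      fun x hx => h (congrArg (fun y => y.2.1) hx)

theorem law_bobBroadcast (n : ℕ) (f : B → Fin n) (next : Fin n → ClassicalLOPC KA KB A B)
    (a : A) (b : B) (o : KA × KB) (i : Fin n) (m : (next i).Msg) :
    (bobBroadcast n f next).law a b (o, (⟨i, m⟩ : Σ i, (next i).Msg)) =
      if f b = i then (next i).law a b (o, m) else 0 := by
  split_ifs with h
  · subst h
    exact map_apply_of_injective ((next (f b)).law a b)
      (f := fun o => (o.1, (⟨f b, o.2⟩ : Σ i, (next i).Msg)))
      (fun x y h => by simpa [Prod.ext_iff] using h) (o, m)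
  · exact map_apply_of_forall_ne ((next (f b)).law a b)
      (f := fun o => (o.1, (⟨f b, o.2⟩ : Σ i, (next i).Msg)))
      fun x hx => h (congrArg (fun y => y.2.1) hx)

theorem toReal_outputLaw_apply {E : Type w} [Fintype A] [Fintype B] [Fintype E] [DecidableEq E]
    (P : ClassicalLOPC KA KB A B) (p : PMF (A × B × E)) (k : KA) (l : KB) (e : E) (m : P.Msg) :
    (P.outputLaw p ((k, l, e), m)).toReal =
      ∑ s, (p s).toReal * if s.2.2 = e then (P.law s.1 s.2.1 ((k, l), m)).toReal else 0 := by
  rw [outputLaw, toReal_bind_apply]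
  refine Finset.sum_congr rfl fun s _ => ?_
  congr 1
  split_ifs with h
  · subst h
    congr 1
    exact map_apply_of_injective (P.law s.1 s.2.1)
      (f := fun o => ((o.1.1, o.1.2, s.2.2), o.2))
      (fun x y h => by simp only [Prod.ext_iff] at h ⊢; tauto) ((k, l), m)
  · rw [map_apply_of_forall_ne _ fun x hx => h (congrArg (fun y => y.1.2.2) hx),
      ENNReal.toReal_zero]

end ClassicalLOPC

/-! ### Classical protocols as quantum protocols -/

/-- The instrument that measures in the computational basis and applies a stochastic kernel. -/
def kernelInstrument {M A A' : Type*} [Fintype M] [Fintype A] [Fintype A']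
    (K : A → PMF (M × A')) : Instrument M A A' where
  op m := measurePrepare fun a a' => (K a (m, a')).toNNReal
  trace_sum σ := by
    classical
    simp only [measurePrepare_lin, Matrix.trace_sum, Matrix.trace_diagonal]
    have h : ∀ a, ∑ m, ∑ a', ((((K a (m, a')).toNNReal : NNReal) : ℝ) : ℂ) = 1 := fun a => by
      have := sum_toReal_eq_one (K a)
      rw [Fintype.sum_prod_type] at this
      have := congrArg (fun x : ℝ => (x : ℂ)) this
      push_cast at this
      exact this
    calc ∑ m, ∑ a', ∑ a, ((((K a (m, a')).toNNReal : NNReal) : ℝ) : ℂ) * σ a a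
        = ∑ a, (∑ m, ∑ a', ((((K a (m, a')).toNNReal : NNReal) : ℝ) : ℂ)) * σ a a := by
          simp only [Finset.sum_mul]
          rw [Finset.sum_comm (s := (Finset.univ : Finset A))]
          exact Finset.sum_congr rfl fun m _ => Finset.sum_comm
      _ = σ.trace := by simp [h, Matrix.trace]

theorem kernelInstrument_lin {M A A' : Type*} [Fintype M] [Fintype A] [Fintype A']
    (K : A → PMF (M × A')) (m : M) (d : A → ℂ) :
    CPMap.lin ((kernelInstrument K).op m) (diagState d) =
      diagState fun a' => ∑ a, ((K a (m, a')).toReal : ℂ) * d a := by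
  classical
  rw [diagState_eq (G := A')]
  refine (measurePrepare_lin _ _).trans ?_
  simp only [diagState_self]
  rfl

/-- Pushing the weights forward along a kernel equals pulling the law back along it. This is the
induction step for Alice's classical operations. -/
theorem sum_kernel_left {A A' B : Type*} [Fintype A] [Fintype A'] [Fintype B] {K : A → A' → ℂ}
    {L : A' → B → ℂ} {L' : A → B → ℂ} (h : ∀ a b, L' a b = ∑ a', K a a' * L a' b)
    (d : A → ℂ) (f : B → ℂ) :
    ∑ a', ∑ b, (∑ a, K a a' * d a) * f b * L a' b = ∑ a, ∑ b, d a * f b * L' a b := by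
  rw [Finset.sum_comm, Finset.sum_comm (s := (Finset.univ : Finset A))]
  refine Finset.sum_congr rfl fun b _ => ?_
  simp only [h, Finset.mul_sum, Finset.sum_mul]
  rw [Finset.sum_comm]
  exact Finset.sum_congr rfl fun a _ => Finset.sum_congr rfl fun a' _ => by ring

theorem sum_kernel_right {A B B' : Type*} [Fintype A] [Fintype B] [Fintype B'] {K : B → B' → ℂ}
    {L : A → B' → ℂ} {L' : A → B → ℂ} (h : ∀ a b, L' a b = ∑ b', K b b' * L a b')
    (d : A → ℂ) (f : B → ℂ) :
    ∑ a, ∑ b', d a * (∑ b, K b b' * f b) * L a b' = ∑ a, ∑ b, d a * f b * L' a b := by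
  refine Finset.sum_congr rfl fun a _ => ?_
  simp only [h, Finset.mul_sum, Finset.sum_mul]
  rw [Finset.sum_comm]
  exact Finset.sum_congr rfl fun b _ => Finset.sum_congr rfl fun b' _ => by ring

theorem sum_map_pair {A S : Type*} [Fintype A] [Fintype S] (q : PMF S) (a : A) (i : Fin 1)
    (F : A × S → ℂ) :
    ∑ x, ((q.map (fun s => ((0 : Fin 1), (a, s))) (i, x)).toReal : ℂ) * F x =
      ∑ s, ((q s).toReal : ℂ) * F (a, s) := by
  obtain rfl : i = 0 := Subsingleton.elim _ _
  rw [Fintype.sum_prod_type, Finset.sum_eq_single a]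
  · refine Finset.sum_congr rfl fun s _ => ?_
    rw [map_apply_of_injective q (f := fun s => ((0 : Fin 1), (a, s)))
      (fun x y h => by simpa using h) s]
  · intro a' _ h
    refine Finset.sum_eq_zero fun s _ => ?_
    rw [map_apply_of_forall_ne _ fun s' hs => h (congrArg (fun y => y.2.1) hs).symm]
    simp
  · simp

theorem sum_pure {M A : Type*} [Fintype A] [DecidableEq M] (i j : M) (a : A) (F : A → ℂ) :
    ∑ x, ((PMF.pure (i, a) (j, x)).toReal : ℂ) * F x = if i = j then F a else 0 := by
  classical
  rw [Finset.sum_eq_single a]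
  · by_cases h : i = j <;> simp [PMF.pure_apply, h, eq_comm]
  · intro x _ h
    simp [PMF.pure_apply, h]
  · simp

/-- A classical protocol, run in the computational basis, is a quantum protocol. It maps states with
diagonal parts of Alice and Bob to states whose diagonal is given by the law of the protocol. -/
theorem ClassicalLOPC.exists_quantumLOPC {KA KB : Type} [Fintype KA] [Fintype KB] {A : Type u}
    {B : Type v} (P : ClassicalLOPC KA KB A B) :
    ∀ [Fintype A] [Fintype B], ∃ (Q : QuantumLOPC KA KB A B) (e : P.Msg ≃ Q.Msg),
      ∀ {E : Type w} (d : A → ℂ) (f : B → ℂ) (ε : Matrix E E ℂ) (m : P.Msg),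
        Q.branch (prodState (diagState d) (diagState f) ε) (e m) =
          Matrix.of fun s t => diagState (fun o : KA × KB =>
            ∑ a, ∑ b, d a * f b * ((P.law a b (o, m)).toReal : ℂ))
              (s.1, s.2.1) (t.1, t.2.1) * ε s.2.2 t.2.2 := by
  classical
  induction P with
  | @output A B κA κB =>
    intro _ _
    refine ⟨.output (kernelInstrument fun a => (κA a).map fun k => ((), k))
      (kernelInstrument fun b => (κB b).map fun l => ((), l)), Equiv.refl _, ?_⟩
    intro E d f ε m
    have hA : ∀ a k, ((κA a).map fun k => ((), k)) ((), k) = κA a k := fun a k =>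
      map_apply_of_injective _ (fun x y h => congrArg Prod.snd h) k
    have hB : ∀ b l, ((κB b).map fun l => ((), l)) ((), l) = κB b l := fun b l =>
      map_apply_of_injective _ (fun x y h => congrArg Prod.snd h) l
    change onBob _ (onAlice _ _) = _
    rw [onAlice_prodState, onBob_prodState, kernelInstrument_lin, kernelInstrument_lin]
    ext ⟨k, l, z⟩ ⟨k', l', z'⟩
    simp only [prodState, Matrix.of_apply, diagState_apply, Prod.mk.injEq, hA, hB, law_output]
    by_cases hk : k = k' <;> by_cases hl : l = l' <;> simp [hk, hl]
    rw [← mul_assoc, Finset.sum_mul_sum]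
    congr 1
    exact Finset.sum_congr rfl fun a _ => Finset.sum_congr rfl fun b _ => by ring
  | @aliceRandom A B S _ q next ih =>
    intro _ _
    obtain ⟨Q, e, h⟩ := @ih inferInstance inferInstance
    -- A step without communication becomes an instrument with one outcome; `Equiv.uniqueSigma`
    -- removes the trivial message it adds.
    refine ⟨.alice (A × S) 1 (kernelInstrument fun x => q.map fun s => (0, (x, s))) fun _ => Q,
      e.trans (Equiv.uniqueSigma fun _ : Fin 1 => Q.Msg).symm, fun d f ε m => ?_⟩
    change Q.branch (onAlice _ _) (e m) = _
    rw [onAlice_prodState, kernelInstrument_lin]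
    refine (h _ _ _ m).trans ?_
    ext s t
    simp only [Matrix.of_apply]
    congr 3
    ext o
    refine sum_kernel_left (fun a b => ?_) d f
    refine Eq.trans ?_ (sum_map_pair q a _ _).symm
    have := toReal_bind_apply q (fun s => next.law (a, s) b) (o, m)
    exact_mod_cast this
  | @aliceMap A B A' _ g next ih =>
    intro _ _
    obtain ⟨Q, e, h⟩ := @ih inferInstance inferInstance
    refine ⟨.alice A' 1 (kernelInstrument fun x => PMF.pure (0, g x)) fun _ => Q,
      e.trans (Equiv.uniqueSigma fun _ : Fin 1 => Q.Msg).symm, fun d f ε m => ?_⟩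
    change Q.branch (onAlice _ _) (e m) = _
    rw [onAlice_prodState, kernelInstrument_lin]
    refine (h _ _ _ m).trans ?_
    ext s t
    simp only [Matrix.of_apply]
    congr 3
    ext o
    refine sum_kernel_left (fun a b => ?_) d f
    refine Eq.trans ?_ (sum_pure _ _ (g a) _).symm
    exact (if_pos (Subsingleton.elim _ _)).symm
  | @aliceBroadcast A B n g next ih =>
    intro _ _
    choose Q e h using fun i => @ih i inferInstance inferInstance
    -- The value `g x` becomes the public outcome, while `x` itself is kept.
    refine ⟨.alice A n (kernelInstrument fun x => PMF.pure (g x, x)) Q,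
      Equiv.sigmaCongrRight e, ?_⟩
    rintro E d f ε ⟨i, m⟩
    change (Q i).branch (onAlice _ _) (e i m) = _
    rw [onAlice_prodState, kernelInstrument_lin]
    refine (h i _ _ _ m).trans ?_
    ext s t
    simp only [Matrix.of_apply]
    congr 3
    ext o
    refine sum_kernel_left (fun a b => ?_) d f
    refine Eq.trans ?_ (sum_pure (g a) i a _).symm
    rw [law_aliceBroadcast]
    split_ifs <;> simp
  | @bobRandom A B S _ q next ih =>
    intro _ _
    obtain ⟨Q, e, h⟩ := @ih inferInstance inferInstance
    refine ⟨.bob (B × S) 1 (kernelInstrument fun x => q.map fun s => (0, (x, s))) fun _ => Q,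
      e.trans (Equiv.uniqueSigma fun _ : Fin 1 => Q.Msg).symm, fun d f ε m => ?_⟩
    change Q.branch (onBob _ _) (e m) = _
    rw [onBob_prodState, kernelInstrument_lin]
    refine (h _ _ _ m).trans ?_
    ext s t
    simp only [Matrix.of_apply]
    congr 3
    ext o
    refine sum_kernel_right (fun a b => ?_) d f
    refine Eq.trans ?_ (sum_map_pair q b _ _).symm
    have := toReal_bind_apply q (fun s => next.law a (b, s)) (o, m)
    exact_mod_cast this
  | @bobMap A B B' _ g next ih =>
    intro _ _
    obtain ⟨Q, e, h⟩ := @ih inferInstance inferInstance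
    refine ⟨.bob B' 1 (kernelInstrument fun x => PMF.pure (0, g x)) fun _ => Q,
      e.trans (Equiv.uniqueSigma fun _ : Fin 1 => Q.Msg).symm, fun d f ε m => ?_⟩
    change Q.branch (onBob _ _) (e m) = _
    rw [onBob_prodState, kernelInstrument_lin]
    refine (h _ _ _ m).trans ?_
    ext s t
    simp only [Matrix.of_apply]
    congr 3
    ext o
    refine sum_kernel_right (fun a b => ?_) d f
    refine Eq.trans ?_ (sum_pure _ _ (g b) _).symm
    exact (if_pos (Subsingleton.elim _ _)).symm
  | @bobBroadcast A B n g next ih =>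
    intro _ _
    choose Q e h using fun i => @ih i inferInstance inferInstance
    refine ⟨.bob B n (kernelInstrument fun x => PMF.pure (g x, x)) Q,
      Equiv.sigmaCongrRight e, ?_⟩
    rintro E d f ε ⟨i, m⟩
    change (Q i).branch (onBob _ _) (e i m) = _
    rw [onBob_prodState, kernelInstrument_lin]
    refine (h i _ _ _ m).trans ?_
    ext s t
    simp only [Matrix.of_apply]
    congr 3
    ext o
    refine sum_kernel_right (fun a b => ?_) d f
    refine Eq.trans ?_ (sum_pure (g b) i b _).symm
    rw [law_bobBroadcast]
    split_ifs <;> simp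

/-! ### Quantum protocols on classical inputs as classical protocols -/

section Sampling

open scoped ComplexOrder

theorem exists_pmf_of_weights {G : Type*} [Fintype G] [Nonempty G] (r : G → ℝ)
    (hr : ∀ g, 0 ≤ r g) : ∃ p : PMF G, ∀ g, r g = (∑ h, r h) * (p g).toReal := by
  rcases (Finset.sum_nonneg fun g (_ : g ∈ Finset.univ) => hr g).eq_or_lt with h | h
  -- With total weight 0 all weights vanish, and any distribution will do.
  · refine ⟨PMF.pure (Classical.arbitrary G), fun g => ?_⟩
    rw [← h, zero_mul]
    exact (Finset.sum_eq_zero_iff_of_nonneg fun g _ => hr g).1 h.symm g (Finset.mem_univ g)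
  · refine ⟨PMF.ofFintype (fun g => ENNReal.ofReal (r g / ∑ h, r h)) ?_, fun g => ?_⟩
    · rw [← ENNReal.ofReal_sum_of_nonneg fun g _ => div_nonneg (hr g) h.le, ← Finset.sum_div,
        div_self h.ne', ENNReal.ofReal_one]
    · rw [PMF.ofFintype_apply, ENNReal.toReal_ofReal (div_nonneg (hr g) h.le),
        mul_div_cancel₀ _ h.ne']

/-- An instrument on a nonempty system preserves the trace 1 of a basis state, and an empty sum
could not. This supplies a default point for the sampling distributions and keeps the systems
nonempty in the induction. -/
theorem Instrument.nonempty_outcome {M A A' : Type*} [Fintype M] [Fintype A] [Fintype A']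
    [Nonempty A] (𝓐 : Instrument M A A') : Nonempty (M × A') := by
  classical
  by_contra h
  have h0 := 𝓐.trace_sum (basisState (Classical.arbitrary A))
  rw [basisState, diagState_eq, Matrix.trace_diagonal, Matrix.trace_sum] at h0
  simp only [Matrix.trace, Matrix.diag] at h0
  have := not_nonempty_iff.1 h
  rw [← Fintype.sum_prod_type', Finset.univ_eq_empty, Finset.sum_empty] at h0
  simp at h0

/-- The joint law of the outcome of an instrument and of a subsequent measurement in the
computational basis. -/
theorem Instrument.exists_sampling {M A A' G : Type*} [Fintype M] [Fintype A] [Fintype A']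
    [Nonempty A] (𝓐 : Instrument M A A') (α : G → Matrix A A ℂ) (hα : ∀ g, (α g).PosSemidef) :
    ∃ K : G → PMF (M × A'), ∀ g m a',
      CPMap.lin (𝓐.op m) (α g) a' a' = (α g).trace * ((K g (m, a')).toReal : ℂ) := by
  have := 𝓐.nonempty_outcome
  have hpos : ∀ g (o : M × A'), 0 ≤ CPMap.lin (𝓐.op o.1) (α g) o.2 o.2 := fun g o =>
    (CPMap.posSemidef (𝓐.op o.1) (hα g)).diag_nonneg
  choose K hK using fun g => exists_pmf_of_weights
    (fun o : M × A' => (CPMap.lin (𝓐.op o.1) (α g) o.2 o.2).re)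
    fun o => (Complex.nonneg_iff.1 (hpos g o)).1
  have hre : ∀ g (o : M × A'), (((CPMap.lin (𝓐.op o.1) (α g) o.2 o.2).re : ℝ) : ℂ) =
      CPMap.lin (𝓐.op o.1) (α g) o.2 o.2 := fun g o =>
    Complex.ext rfl (Complex.nonneg_iff.1 (hpos g o)).2
  refine ⟨K, fun g m a' => ?_⟩
  have h := congrArg (fun x : ℝ => (x : ℂ)) (hK g (m, a'))
  simp only [Complex.ofReal_mul, Complex.ofReal_sum, hre] at h
  refine (hre g (m, a')).symm.trans (h.trans ?_)
  -- Trace preservation identifies the total weight with the trace of `α g`.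
  rw [← 𝓐.trace_sum, Matrix.trace_sum, Fintype.sum_prod_type]
  rfl

theorem toReal_map_fst {M A : Type*} [Fintype M] [Fintype A] (p : PMF (M × A)) (m : M) :
    (p.map Prod.fst m).toReal = ∑ a, (p (m, a)).toReal := by
  classical
  rw [PMF.map, toReal_bind_apply, Fintype.sum_prod_type, Finset.sum_eq_single m]
  · simp
  · intro m' _ h
    simp [PMF.pure_apply, h.symm]
  · simp

theorem Instrument.exists_outcome_law {M A A' G : Type*} [Fintype M] [Fintype A] [Fintype A']
    [Nonempty A] (𝓐 : Instrument M A A') (α : G → Matrix A A ℂ) (hα : ∀ g, (α g).PosSemidef) :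
    ∃ D : G → PMF M, ∀ g m,
      (CPMap.lin (𝓐.op m) (α g)).trace = (α g).trace * ((D g m).toReal : ℂ) := by
  obtain ⟨K, hK⟩ := 𝓐.exists_sampling α hα
  refine ⟨fun g => (K g).map Prod.fst, fun g m => ?_⟩
  rw [toReal_map_fst]
  push_cast
  rw [Finset.mul_sum]
  exact Finset.sum_congr rfl fun a' _ => hK g m a'

theorem Channel.exists_output_law {A A' G : Type*} [Fintype A] [Fintype A']
    [Nonempty A] (𝓐 : Channel A A') (α : G → Matrix A A ℂ) (hα : ∀ g, (α g).PosSemidef) :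
    ∃ κ : G → PMF A', ∀ g a',
      CPMap.lin (𝓐.op ()) (α g) a' a' = (α g).trace * ((κ g a').toReal : ℂ) := by
  obtain ⟨K, hK⟩ := Instrument.exists_sampling 𝓐 α hα
  refine ⟨fun g => (K g).map Prod.snd, fun g a' => ?_⟩
  have : (K g).map Prod.snd a' = K g ((), a') :=
    map_apply_of_injective (K g) (f := Prod.snd) (fun x y h => Prod.ext rfl h) ((), a')
  rw [this]
  exact hK g () a'

/-- A quantum protocol on inputs that depend on classical variables of Alice and Bob is simulated
by a classical protocol: each party samples the outcomes of her instruments from her description of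
her own state, and finally samples a computational basis measurement. -/
theorem QuantumLOPC.exists_classicalLOPC {KA KB : Type} [Fintype KA] [Fintype KB] {A : Type u}
    {B : Type v} [Fintype A] [Fintype B] (Q : QuantumLOPC KA KB A B) :
    ∀ [Nonempty A] [Nonempty B] {X : Type u} {Y : Type v} [Fintype X] [Fintype Y]
      (α : X → Matrix A A ℂ) (β : Y → Matrix B B ℂ) (_ : ∀ x, (α x).PosSemidef)
      (_ : ∀ y, (β y).PosSemidef),
      ∃ (P : ClassicalLOPC KA KB X Y) (e : P.Msg ≃ Q.Msg),
        ∀ {E : Type w} (ε : Matrix E E ℂ) (x : X) (y : Y) (k : KA) (l : KB) (z : E) (m : P.Msg),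
          Q.branch (prodState (α x) (β y) ε) (e m) (k, l, z) (k, l, z) =
            (α x).trace * (β y).trace * ((P.law x y ((k, l), m)).toReal : ℂ) * ε z z := by
  classical
  induction Q with
  | output 𝓐 𝓑 =>
    intro _ _ X Y _ _ α β hα hβ
    obtain ⟨κA, hA⟩ := Channel.exists_output_law 𝓐 α hα
    obtain ⟨κB, hB⟩ := Channel.exists_output_law 𝓑 β hβ
    refine ⟨.output κA κB, Equiv.refl _, fun ε x y k l z m => ?_⟩
    change onBob _ (onAlice _ _) _ _ = _
    rw [onAlice_prodState, onBob_prodState, ClassicalLOPC.law_output, ENNReal.toReal_mul]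
    simp only [prodState, Matrix.of_apply, hA, hB]
    push_cast
    ring
  | @alice A B _ _ A' _ n 𝓐 next ih =>
    intro _ _ X Y _ _ α β hα hβ
    have hA' : Nonempty A' := 𝓐.nonempty_outcome.map Prod.snd
    obtain ⟨D, hD⟩ := 𝓐.exists_outcome_law α hα
    obtain ⟨q, hq⟩ := exists_pmf_pi D
    -- The states after outcome `i` are left unnormalised and are still indexed by Alice's original
    -- variable: her description of her state is a function of `x` and the transcript.
    choose P e h using fun i => ih i (fun x => CPMap.lin (𝓐.op i) (α x)) β
      (fun x => CPMap.posSemidef _ (hα x)) hβ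
    -- Fresh randomness must be independent of `x`, whereas the outcome law `D x` depends on it. So
    -- an outcome is drawn in advance for every possible `x`, the one at the actual `x` is
    -- broadcast, and the table is discarded.
    refine ⟨.aliceRandom (X → Fin n) q (.aliceBroadcast n (fun x => x.2 x.1)
      fun i => .aliceMap X Prod.fst (P i)), Equiv.sigmaCongrRight e, ?_⟩
    rintro E ε x y k l z ⟨i, m⟩
    change (next i).branch (onAlice _ _) (e i m) _ _ = _
    rw [onAlice_prodState]
    refine (h i ε x y k l z m).trans ?_
    rw [hD]
    have hlaw := toReal_bind_apply q (fun g => (ClassicalLOPC.aliceBroadcast n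
      (fun x : X × (X → Fin n) => x.2 x.1) fun i => .aliceMap X Prod.fst (P i)).law (x, g) y)
      ((k, l), (⟨i, m⟩ : Σ i, (P i).Msg))
    have hb : ∀ g : X → Fin n, ((ClassicalLOPC.aliceBroadcast n
        (fun x : X × (X → Fin n) => x.2 x.1) fun i => .aliceMap X Prod.fst (P i)).law (x, g) y
        ((k, l), (⟨i, m⟩ : Σ i, (P i).Msg))).toReal =
        if g x = i then ((P i).law x y ((k, l), m)).toReal else 0 := fun g => by
      refine (congrArg ENNReal.toReal
        (ClassicalLOPC.law_aliceBroadcast _ _ _ _ _ _ _ _)).trans ?_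
      exact (apply_ite _ _ _ _).trans (by rfl)
    simp only [hb] at hlaw
    -- Only the marginal of the table at `x` matters: its entry there equals `i` with probability `D
    -- x i`.
    rw [hq x fun j => if j = i then ((P i).law x y ((k, l), m)).toReal else 0] at hlaw
    simp only [mul_ite, mul_zero, Finset.sum_ite_eq', Finset.mem_univ, if_true] at hlaw
    have hlaw' := congrArg (fun r : ℝ => (α x).trace * (β y).trace * (r : ℂ) * ε z z) hlaw
    refine Eq.trans ?_ hlaw'.symm
    push_cast
    ring
  | @bob A B _ _ B' _ n 𝓑 next ih =>
    intro _ _ X Y _ _ α β hα hβ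
    have hB' : Nonempty B' := 𝓑.nonempty_outcome.map Prod.snd
    obtain ⟨D, hD⟩ := 𝓑.exists_outcome_law β hβ
    obtain ⟨q, hq⟩ := exists_pmf_pi D
    choose P e h using fun i => ih i α (fun y => CPMap.lin (𝓑.op i) (β y))
      hα (fun y => CPMap.posSemidef _ (hβ y))
    refine ⟨.bobRandom (Y → Fin n) q (.bobBroadcast n (fun y => y.2 y.1)
      fun i => .bobMap Y Prod.fst (P i)), Equiv.sigmaCongrRight e, ?_⟩
    rintro E ε x y k l z ⟨i, m⟩
    change (next i).branch (onBob _ _) (e i m) _ _ = _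
    rw [onBob_prodState]
    refine (h i ε x y k l z m).trans ?_
    rw [hD]
    have hlaw := toReal_bind_apply q (fun g => (ClassicalLOPC.bobBroadcast n
      (fun y : Y × (Y → Fin n) => y.2 y.1) fun i => .bobMap Y Prod.fst (P i)).law x (y, g))
      ((k, l), (⟨i, m⟩ : Σ i, (P i).Msg))
    have hb : ∀ g : Y → Fin n, ((ClassicalLOPC.bobBroadcast n
        (fun y : Y × (Y → Fin n) => y.2 y.1) fun i => .bobMap Y Prod.fst (P i)).law x (y, g)
        ((k, l), (⟨i, m⟩ : Σ i, (P i).Msg))).toReal =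
        if g y = i then ((P i).law x y ((k, l), m)).toReal else 0 := fun g => by
      refine (congrArg ENNReal.toReal
        (ClassicalLOPC.law_bobBroadcast _ _ _ _ _ _ _ _)).trans ?_
      exact (apply_ite _ _ _ _).trans (by rfl)
    simp only [hb] at hlaw
    rw [hq y fun j => if j = i then ((P i).law x y ((k, l), m)).toReal else 0] at hlaw
    simp only [mul_ite, mul_zero, Finset.sum_ite_eq', Finset.mem_univ, if_true] at hlaw
    have hlaw' := congrArg (fun r : ℝ => (α x).trace * (β y).trace * (r : ℂ) * ε z z) hlaw
    refine Eq.trans ?_ hlaw'.symm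
    push_cast
    ring

end Sampling

/-! ### Comparison of the key rates -/

section Comparison

open scoped ComplexOrder

variable {s : ℕ} {A : Type u} {B : Type v} {E : Type w} [Fintype A] [Fintype B] [Fintype E]

theorem basisState_eq {G : Type*} [DecidableEq G] (g : G) :
    basisState g = Matrix.diagonal (Pi.single g 1) := by
  obtain rfl : ‹DecidableEq G› = Classical.decEq G := Subsingleton.elim _ _
  rfl

theorem basisState_self {G : Type*} [DecidableEq G] (g h : G) :
    basisState g h h = if g = h then 1 else 0 := by
  rw [basisState_eq, Matrix.diagonal_apply_eq, Pi.single_apply]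
  simp only [eq_comm]

theorem posSemidef_basisState {G : Type*} [Fintype G] (g : G) : (basisState g).PosSemidef := by
  classical
  rw [basisState_eq]
  refine Matrix.PosSemidef.diagonal fun h => ?_
  rw [Pi.single_apply]
  split_ifs <;> simp

theorem trace_basisState {G : Type*} [Fintype G] (g : G) : (basisState g).trace = 1 := by
  classical
  simp [basisState_eq, Matrix.trace_diagonal]

theorem QuantumLOPC.outputState_apply_eq {KA KB : Type} [Fintype KA] [Fintype KB]
    {E : Type w} (Q : QuantumLOPC KA KB A B) (σ : Matrix (A × B × E) (A × B × E) ℂ)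
    (g h : KA × KB × E) (m : Q.Msg) : Q.outputState σ (g, m) (h, m) = Q.branch σ m g h :=
  letI := Classical.decEq Q.Msg
  Matrix.blockDiagonal_apply_eq _ _ _ _

theorem QuantumLOPC.outputState_apply_ne {KA KB : Type} [Fintype KA] [Fintype KB]
    {E : Type w} (Q : QuantumLOPC KA KB A B) (σ : Matrix (A × B × E) (A × B × E) ℂ)
    (g h : KA × KB × E) {m m' : Q.Msg} (hm : m ≠ m') : Q.outputState σ (g, m) (h, m') = 0 :=
  letI := Classical.decEq Q.Msg
  Matrix.blockDiagonal_apply_ne _ _ _ hm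

/-- `P` has the same statistics as `Q` followed by measurements in the computational basis. -/
def HasDiagonalLaw {KA KB : Type} [Fintype KA] [Fintype KB] (P : ClassicalLOPC KA KB A B)
    (Q : QuantumLOPC KA KB A B) (e : P.Msg ≃ Q.Msg) (E : Type w) : Prop :=
  ∀ (x : A) (y : B) (z z' : E) (k : KA) (l : KB) (m : P.Msg),
    Q.branch (prodState (basisState x) (basisState y) (basisState z)) (e m) (k, l, z') (k, l, z') =
      ((P.law x y ((k, l), m)).toReal : ℂ) * basisState z z' z'

theorem HasDiagonalLaw.outputState_diag {KA KB : Type} [Fintype KA] [Fintype KB]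
    {P : ClassicalLOPC KA KB A B} {Q : QuantumLOPC KA KB A B} {e : P.Msg ≃ Q.Msg}
    (h : HasDiagonalLaw P Q e E) (p : PMF (A × B × E)) (g : KA × KB × E) (m : P.Msg) :
    Q.outputState (classicalState p) (g, e m) (g, e m) = ((P.outputLaw p (g, m)).toReal : ℂ) := by
  classical
  obtain ⟨k, l, z⟩ := g
  rw [ClassicalLOPC.toReal_outputLaw_apply, QuantumLOPC.outputState_apply_eq,
    QuantumLOPC.branch_classicalState, Matrix.sum_apply]
  push_cast
  refine Finset.sum_congr rfl fun x _ => ?_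
  rw [Matrix.smul_apply, h, basisState_self]
  split_ifs <;> simp

/-- The classical error is exactly the diagonal part of the quantum one, up to relabelling the
messages by `e`. Both simulations are compared through this identity. -/
theorem HasDiagonalLaw.diagError_eq {P : ClassicalLOPC (Fin s) (Fin s) A B}
    {Q : QuantumLOPC (Fin s) (Fin s) A B} {e : P.Msg ≃ Q.Msg} (h : HasDiagonalLaw P Q e E)
    (p : PMF (A × B × E)) :
    keyError s (classicalState (P.outputLaw p)) (classicalState p) =
      diagError s (fun g => Q.outputState (classicalState p) g g)
        (fun z => eveMarginal (classicalState p) z z) := by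
  classical
  have hp : classicalState p = Matrix.diagonal fun g => ((p g).toReal : ℂ) := diagState_eq _
  have hP : classicalState (P.outputLaw p) =
    Matrix.diagonal fun g => ((P.outputLaw p g).toReal : ℂ) := diagState_eq _
  have hv : (fun z => eveMarginal (classicalState p) z z) =
      fun z => ∑ a, ∑ b, ((p (a, b, z)).toReal : ℂ) := by
    ext z
    simp [eveMarginal, hp]
  rw [hv, hP]
  conv_lhs => rw [hp]
  rw [keyError_diagonal]
  exact diagError_reindex s e _ _ (fun g m => (h.outputState_diag p g m).symm) _

/-- A quantum protocol on a classical state is at least matched by a classical protocol. -/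
theorem exists_classical_keyError_le (p : PMF (A × B × E))
    (Q : QuantumLOPC (Fin s) (Fin s) A B) :
    ∃ P : ClassicalLOPC (Fin s) (Fin s) A B,
      keyError s (classicalState (P.outputLaw p)) (classicalState p) ≤
        keyError s (Q.outputState (classicalState p)) (classicalState p) := by
  -- A probability distribution cannot live on an empty product, so both local systems are nonempty.
  obtain ⟨⟨a, b, -⟩, -⟩ := p.support_nonempty
  have : Nonempty A := ⟨a⟩
  have : Nonempty B := ⟨b⟩
  obtain ⟨P, e, h⟩ := Q.exists_classicalLOPC (basisState : A → _) (basisState : B → _)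
    posSemidef_basisState posSemidef_basisState
  have hD : HasDiagonalLaw P Q e E := fun x y z z' k l m => by
    rw [h, trace_basisState, trace_basisState, one_mul, one_mul]
  exact ⟨P, (hD.diagError_eq p).trans_le (diagError_le_keyError _ _ _)⟩

/-- Every classical protocol on a classical state is a quantum protocol. -/
theorem exists_quantum_keyError_eq (p : PMF (A × B × E))
    (P : ClassicalLOPC (Fin s) (Fin s) A B) :
    ∃ Q : QuantumLOPC (Fin s) (Fin s) A B,
      keyError s (Q.outputState (classicalState p)) (classicalState p) =
        keyError s (classicalState (P.outputLaw p)) (classicalState p) := by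
  classical
  obtain ⟨Q, e, h⟩ := P.exists_quantumLOPC
  have h' : ∀ (x : A) (y : B) (z : E) (m : P.Msg),
      Q.branch (prodState (basisState x) (basisState y) (basisState z)) (e m) =
        Matrix.of fun s t => diagState (fun o => ((P.law x y (o, m)).toReal : ℂ))
          (s.1, s.2.1) (t.1, t.2.1) * basisState z s.2.2 t.2.2 := fun x y z m => by
    refine (h _ _ _ m).trans ?_
    simp [Pi.single_apply]
  have hD : HasDiagonalLaw P Q e E := fun x y z z' k l m => by
    rw [h', Matrix.of_apply, diagState_self]
  -- With a diagonal output nothing is lost in passing to the diagonal, which turns the inequality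
  -- of errors into an equality.
  have hdiag : Q.outputState (classicalState p) =
      Matrix.diagonal fun g => Q.outputState (classicalState p) g g := by
    symm
    refine Matrix.IsDiag.diagonal_diag ?_
    rintro ⟨⟨k, l, z⟩, m⟩ ⟨⟨k', l', z'⟩, m'⟩ hne
    obtain ⟨m, rfl⟩ := e.surjective m
    by_cases hm : e m = m'
    · subst hm
      refine (Q.outputState_apply_eq _ _ _ _).trans ?_
      rw [QuantumLOPC.branch_classicalState, Matrix.sum_apply]
      refine Finset.sum_eq_zero fun x _ => ?_
      rw [Matrix.smul_apply, h', Matrix.of_apply]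
      by_cases hz : z = z'
      · rw [diagState_ne _ fun hkl => hne (by simp_all), zero_mul, smul_zero]
      · rw [basisState, diagState_ne _ hz, mul_zero, smul_zero]
    · exact Q.outputState_apply_ne _ _ _ hm
  refine ⟨Q, ?_⟩
  have hp : classicalState p = Matrix.diagonal fun g => ((p g).toReal : ℂ) := diagState_eq _
  have hv : (fun z => eveMarginal (classicalState p) z z) =
      fun z => ∑ a, ∑ b, ((p (a, b, z)).toReal : ℂ) := by
    ext z
    simp [eveMarginal, hp]
  rw [hD.diagError_eq p, hv, hdiag]
  conv_lhs => arg 3; rw [hp]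
  rw [keyError_diagonal]
  simp only [Matrix.diagonal_apply_eq]

end Comparison

/-- Since the tensor power of the embedding is the classical state of `iid p n`, the two simulations
apply for each `n` separately, with the same `ε` and key size. -/
theorem isClassicallyAchievable_iff {X : Type u} {Y : Type v} {Z : Type w} [Fintype X] [Fintype Y]
    [Fintype Z] (p : PMF (X × Y × Z)) (R : ℝ) :
    IsClassicallyAchievable p R ↔ IsQuantumAchievable (incoherentEmbedding p) R := by
  simp only [IsClassicallyAchievable, IsQuantumAchievable, tensorPower_incoherentEmbedding]
  refine forall₂_congr fun ε hε => Filter.eventually_congr (.of_forall fun n => ?_)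
  constructor
  · rintro ⟨P, hP⟩
    obtain ⟨Q, hQ⟩ := exists_quantum_keyError_eq (iid p n) P
    exact ⟨Q, hQ.trans_lt hP⟩
  · rintro ⟨Q, hQ⟩
    obtain ⟨P, hP⟩ := exists_classical_keyError_le (iid p n) Q
    exact ⟨P, hP.trans_lt hQ⟩

end KeyDistillation

end

theorem mainTheorem2 {X Y Z : Type*} [Fintype X] [Fintype Y] [Fintype Z]
    (p : PMF (X × Y × Z)) :
    KeyDistillation.classicalKeyRate p =
      KeyDistillation.quantumKeyRate (KeyDistillation.incoherentEmbedding p) := by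
  simp only [KeyDistillation.classicalKeyRate, KeyDistillation.quantumKeyRate,
    KeyDistillation.isClassicallyAchievable_iff]
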